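/- Let $\sigma^X,\sigma^Y,\sigma^Z$ be the Pauli matrices, $S^U=\sigma^U/2$, $\rho=\mathbb 1/2\in M_2(\mathbb C)$, and let $\|\cdot\|$ and $\|\cdot\|_2$ denote the operator and Hilbert–Schmidt norms of matrices. Adjoints of maps between matrix algebras, and the notation $|B\rangle\langle C|\colon A\mapsto \mathrm{Tr}(C^*A)\,B$, refer to the Hilbert–Schmidt inner product. Let $$\mathbb E=|\mathbb 1\rangle\langle\rho|-\tfrac13\sum_{U=X,Y,Z}|\sigma^U\rangle\langle S^U|$$ be the transfer operator of the spin-1 AKLT chain on $M_2(\mathbb C)$. For $d\ge 1$ and $0\le k\le d$ let $\phi^m_k\in(\mathbb C^2)^{\otimes m}$ be the normalized symmetric vector with $k$ up spins, $K=|{\uparrow}\rangle\langle{\downarrow}|-|{\downarrow}\rangle\langle{\uparrow}|$, $$V^d_k=\sqrt{\tfrac{d-k}{d}}\,|{\downarrow}\rangle\langle\phi^{d-1}_k|+\sqrt{\tfrac kd}\,|{\uparrow}\rangle\langle\phi^{d-1}_{k-1}|,\qquad W^d_k=KV^d_k,\qquad \tilde W^d_k=K^{\otimes (d-1)}(V^d_k)^*,$$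 where a term with coefficient $0$ is omitted. For $n\ge0$ define $\mathbb E_L^{(d,n)}\colon M_2(\mathbb C)\to M_2(\mathbb C)^{\otimes (d-1)}$ and $\mathbb E_R^{(d,n)}\colon M_2(\mathbb C)^{\otimes (d-1)}\to M_2(\mathbb C)$ by $$\mathbb E_L^{(d,n)}(B)=(\mathbb E^{\otimes (d-1)})^n\Big(\sum_{k=0}^d (W^d_k)^*BW^d_k\Big),\qquad \mathbb E_R^{(d,n)}(B)=\sum_{k=0}^d (\tilde W^d_k)^*\,(\mathbb E^{\otimes (d-1)})^n(B)\,\tilde W^d_k .$$ For a linear map $T$ between matrix algebras put $\|T\|_\infty=\sup_{A\ne0}\|T(A)\|_2/\|A\|_2$ (its Schatten-$\infty$ norm) and $\|T\|_{\rm op}=\sup_{A\neq0}\|T(A)\|/\|A\|$. Let $a(n)=\|\mathbb E^n-|\mathbb 1\rangle\langle\rho|\,\|_\infty$, and let $q_L^{(d,n)}$ and $q_R^{(d,n)}$ be the minimal eigenvalues of $\mathbb E_L^{(d,n)}(\mathbb 1)$ and $(\mathbb E_R^{(d,n)})^*(\rho)$. Given an edge $(v_L,v_R)$ of a simple graph with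 degrees $d_L,d_R$, write $\mathbb E_\#=\mathbb E_\#^{(d_\#,n)}$ and $q_\#=q_\#^{(d_\#,n)}$ for $\#\in\{L,R\}$, and set $$b_L^\infty(n)=4a(n)\frac{\|\mathbb E_L\|_\infty}{q_L},\quad b_R^\infty(n)=2a(n)\frac{\|\mathbb E_R\|_\infty}{q_R},\quad b_{LR}^\infty(n)=\frac{b_L^\infty(n)b_R^\infty(n)}{4a(n)},$$ $$b_L^{\rm op}(n)=8a(n)\frac{\|\mathbb E_L\|_{\rm op}}{q_L},\quad b_R^{\rm op}(n)=4a(n)\frac{\|\mathbb E_R\|_{\rm op}}{q_R},\quad b_{LR}^{\rm op}(n)=\frac{b_L^{\rm op}(n)b_R^{\rm op}(n)}{8a(n)},$$ $$\delta^\infty(n)=4a(n)\left(\frac1{\sqrt{(1-b_L^\infty(n))(1-b_R^\infty(n))}}+\frac{4a(n)+b_L^\infty(n)b_R^\infty(n)}{(1-b_L^\infty(n))(1-b_R^\infty(n))}\right),$$ $$\delta^{\rm op}(n)=4a(n)\left(\frac1{\sqrt{(1-b_L^{\rm op}(n))(1-b_R^{\rm op}(n))}}+\frac{4a(n)(1+b_{LR}^{\rm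 op}(n))}{(1-b_L^{\rm op}(n))(1-b_R^{\rm op}(n))}\right).$$ **Proposition.** Let $G=(V,E)$ be a simple graph with $\deg(v)=d$ for all $v\in V$, where $d\ge2$, and let $n\in\mathbb N$ satisfy $$n\ \ge\ \frac{\ln(d-1)}{\ln 3}-\frac{\ln(\ln 3)}{\ln 3}+\frac12 .$$ Then for every edge $(v_L,v_R)$ of $G$: 1. $b_{LR}^\infty(n)<b_{LR}^{\rm op}(n)$. 2. If $b_L^{\rm op}(n)\le1$ and $b_R^{\rm op}(n)\le 1$, then $b_L^\infty(n)<1$, $b_R^\infty(n)<1$ and $$\sqrt{(1-b_L^{\rm op}(n))(1-b_R^{\rm op}(n))}<\sqrt{(1-b_L^\infty(n))(1-b_R^\infty(n))}.$$ 3. If $b_L^{\rm op}(n)<1$ and $b_R^{\rm op}(n)<1$, so that $\delta^{\rm op}(n)$ is defined, then $\delta^\infty(n)<\delta^{\rm op}(n)$. -/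

import Mathlib

open scoped Matrix

noncomputable section

namespace AKLT

/-- Configurations of `m` spins one half; `0` is "up" and `1` is "down". They label the standard
basis of the `m`-fold tensor power of `ℂ²`. -/
abbrev Conf (m : ℕ) : Type := Fin m → Fin 2

/-- The matrix algebra of `m` spins one half, the `m`-fold tensor power of the algebra of complex
`2 × 2` matrices, realised as the matrices indexed by configurations. -/
abbrev SpinMat (m : ℕ) : Type := Matrix (Conf m) (Conf m) ℂ

section Norms

variable {p q : Type} [Fintype p] [DecidableEq p] [Fintype q] [DecidableEq q]

/-- The Hilbert–Schmidt inner product `Tr (A* B)`. -/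
def hsInner (A B : Matrix p p ℂ) : ℂ := (Aᴴ * B).trace

/-- The Hilbert–Schmidt norm. -/
def hsNorm (A : Matrix p p ℂ) : ℝ := √(∑ i, ∑ j, ‖A i j‖ ^ 2)

/-- The operator norm of a matrix acting on the Euclidean space `ℂᵖ`. -/
def opNorm (A : Matrix p p ℂ) : ℝ := ‖Matrix.toEuclideanCLM (𝕜 := ℂ) A‖

/-- The Schatten-`∞` norm of a linear map between matrix algebras, both carrying the
Hilbert–Schmidt norm (equivalently, its largest singular value). -/
def schattenInfty (T : Matrix p p ℂ →ₗ[ℂ] Matrix q q ℂ) : ℝ :=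
  sSup {x : ℝ | ∃ A : Matrix p p ℂ, A ≠ 0 ∧ x = hsNorm (T A) / hsNorm A}

/-- The norm of a linear map between matrix algebras that is induced by the operator norms. -/
def inducedOpNorm (T : Matrix p p ℂ →ₗ[ℂ] Matrix q q ℂ) : ℝ :=
  sSup {x : ℝ | ∃ A : Matrix p p ℂ, A ≠ 0 ∧ x = opNorm (T A) / opNorm A}

/-- The smallest real spectral value: the minimal eigenvalue, for a Hermitian matrix. -/
def minEigenvalue (A : Matrix p p ℂ) : ℝ := sInf (spectrum ℝ A)

/-- The rank-one map `|B⟩⟨C|`, that is `A ↦ ⟨C, A⟩ B`, for the Hilbert–Schmidt inner product. -/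
def ketBra (B : Matrix q q ℂ) (C : Matrix p p ℂ) : Matrix p p ℂ →ₗ[ℂ] Matrix q q ℂ where
  toFun A := hsInner C A • B
  map_add' A A' := by simp [hsInner, Matrix.mul_add, add_smul]
  map_smul' c A := by simp [hsInner, smul_smul]

/-- The adjoint of a linear map with respect to the Hilbert–Schmidt inner products; its defining
property is `hsInner_hsAdjoint`. -/
def hsAdjoint (T : Matrix p p ℂ →ₗ[ℂ] Matrix q q ℂ) : Matrix q q ℂ →ₗ[ℂ] Matrix p p ℂ where
  toFun B := Matrix.of fun i j => hsInner (T (Matrix.single i j 1)) B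
  map_add' B B' := by ext i j; simp [hsInner, Matrix.mul_add]
  map_smul' c B := by ext i j; simp [hsInner]

theorem hsInner_hsAdjoint (T : Matrix p p ℂ →ₗ[ℂ] Matrix q q ℂ) (A : Matrix p p ℂ)
    (B : Matrix q q ℂ) : hsInner A (hsAdjoint T B) = hsInner (T A) B := by
  have hA : T A = ∑ i, ∑ j, A i j • T (Matrix.single i j 1) := by
    conv_lhs => rw [Matrix.matrix_eq_sum_single A]
    simp only [map_sum]
    refine Finset.sum_congr rfl fun i _ => Finset.sum_congr rfl fun j _ => ?_
    rw [← map_smul, Matrix.smul_single, smul_eq_mul, mul_one]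
  rw [hA]
  simp only [hsInner, Matrix.conjTranspose_sum, Matrix.conjTranspose_smul, Finset.sum_mul,
    Matrix.trace_sum, Matrix.smul_mul, Matrix.trace_smul, smul_eq_mul]
  simp only [Matrix.trace, Matrix.diag_apply, Matrix.mul_apply, Matrix.conjTranspose_apply,
    hsAdjoint, hsInner, LinearMap.coe_mk, AddHom.coe_mk, Matrix.of_apply]
  exact Finset.sum_comm

/-- The completely positive map `B ↦ ∑ₖ Wₖ* B Wₖ`, with `k` running from `0` to `d`. -/
def krausMap (d : ℕ) (W : ℕ → Matrix p q ℂ) : Matrix p p ℂ →ₗ[ℂ] Matrix q q ℂ where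
  toFun B := ∑ k ∈ Finset.range (d + 1), (W k)ᴴ * B * W k
  map_add' B B' := by simp [Matrix.mul_add, Matrix.add_mul, Finset.sum_add_distrib]
  map_smul' c B := by simp [Finset.smul_sum]

end Norms

/-- The Pauli matrices `σ^X`, `σ^Y`, `σ^Z`. -/
def pauli : Fin 3 → Matrix (Fin 2) (Fin 2) ℂ :=
  ![!![0, 1; 1, 0], !![0, -Complex.I; Complex.I, 0], !![1, 0; 0, -1]]

/-- The spin matrices `S^U = σ^U / 2`. -/
def spin (U : Fin 3) : Matrix (Fin 2) (Fin 2) ℂ := (1 / 2 : ℂ) • pauli U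

/-- `ρ = 𝟙 / 2`. -/
def rho : Matrix (Fin 2) (Fin 2) ℂ := (1 / 2 : ℂ) • 1

/-- The transfer operator `𝔼` of one site of the spin-1 AKLT chain,
`𝔼 = |𝟙⟩⟨ρ| - (1/3) ∑_U |σ^U⟩⟨S^U|`. -/
def siteTransfer : Module.End ℂ (Matrix (Fin 2) (Fin 2) ℂ) :=
  ketBra 1 rho - (1 / 3 : ℂ) • ∑ U, ketBra (pauli U) (spin U)

/-- The convergence rate `a(n) = ‖𝔼ⁿ - |𝟙⟩⟨ρ|‖`. -/
def rate (n : ℕ) : ℝ := schattenInfty (siteTransfer ^ n - ketBra 1 rho)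

/-- The elementary tensor `A₁ ⊗ ⋯ ⊗ A_m` of `2 × 2` matrices. -/
def pureTensor {m : ℕ} (A : Fin m → Matrix (Fin 2) (Fin 2) ℂ) : SpinMat m :=
  Matrix.of fun s t => ∏ i, A i (s i) (t i)

/-- The tensor power `T ⊗ ⋯ ⊗ T` (`m` factors) of a linear map `T` on `2 × 2` matrices; it is
characterised by `tensorPower_pureTensor`. -/
def tensorPower (m : ℕ) (T : Module.End ℂ (Matrix (Fin 2) (Fin 2) ℂ)) :
    Module.End ℂ (SpinMat m) where
  toFun A := Matrix.of fun s t =>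
    ∑ u : Conf m, ∑ v : Conf m, A u v * ∏ i, T (Matrix.single (u i) (v i) 1) (s i) (t i)
  map_add' A B := by ext s t; simp [add_mul, Finset.sum_add_distrib]
  map_smul' c A := by ext s t; simp [Finset.mul_sum, mul_assoc]

theorem tensorPower_pureTensor (m : ℕ) (T : Module.End ℂ (Matrix (Fin 2) (Fin 2) ℂ))
    (A : Fin m → Matrix (Fin 2) (Fin 2) ℂ) :
    tensorPower m T (pureTensor A) = pureTensor fun i => T (A i) := by
  have hT : ∀ (B : Matrix (Fin 2) (Fin 2) ℂ) (a b : Fin 2),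
      T B a b = ∑ x, ∑ y, B x y * T (Matrix.single x y 1) a b := by
    intro B a b
    conv_lhs => rw [Matrix.matrix_eq_sum_single B]
    simp only [map_sum, Matrix.sum_apply]
    refine Finset.sum_congr rfl fun i _ => Finset.sum_congr rfl fun j _ => ?_
    have : Matrix.single i j (B i j) = B i j • Matrix.single i j (1 : ℂ) := by
      rw [Matrix.smul_single, smul_eq_mul, mul_one]
    rw [this, map_smul, Matrix.smul_apply, smul_eq_mul]
  ext s t
  simp only [tensorPower, pureTensor, LinearMap.coe_mk, AddHom.coe_mk, Matrix.of_apply,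
    ← Finset.prod_mul_distrib]
  simp_rw [hT (A _)]
  rw [Finset.prod_univ_sum]
  simp_rw [Finset.prod_univ_sum, Fintype.piFinset_univ]

/-- The normalized symmetric vector of `m` spins one half with exactly `k` spins up. -/
def symVec (m k : ℕ) : Conf m → ℂ := fun s =>
  if (Finset.univ.filter fun i => s i = 0).card = k then ((1 / √(m.choose k : ℝ) : ℝ) : ℂ) else 0

/-- The singlet tensor `K = |↑⟩⟨↓| - |↓⟩⟨↑|`. -/
def singlet : Matrix (Fin 2) (Fin 2) ℂ := !![0, 1; -1, 0]

/-- The matrix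
`V_k^d = √((d-k)/d) |↓⟩⟨φ_k^{d-1}| + √(k/d) |↑⟩⟨φ_{k-1}^{d-1}|` for `0 ≤ k ≤ d`; the second term
vanishes for `k = 0`. -/
def vTensor (d k : ℕ) : Matrix (Fin 2) (Conf (d - 1)) ℂ :=
  ((√(((d : ℝ) - k) / d) : ℝ) : ℂ) •
      Matrix.vecMulVec (Pi.single 1 1) (star (symVec (d - 1) k)) +
    ((√((k : ℝ) / d) : ℝ) : ℂ) •
      Matrix.vecMulVec (Pi.single 0 1) (star (symVec (d - 1) (k - 1)))

/-- The tensors `W_k^d = K V_k^d` of the left vertex. -/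
def wLeft (d k : ℕ) : Matrix (Fin 2) (Conf (d - 1)) ℂ := singlet * vTensor d k

/-- The tensors `K ⊗ ⋯ ⊗ K (V_k^d)*` of the right vertex. -/
def wRight (d k : ℕ) : Matrix (Conf (d - 1)) (Fin 2) ℂ :=
  pureTensor (fun _ => singlet) * (vTensor d k)ᴴ

/-- The transfer operator `𝔼_L^{(d,n)}` of a left vertex of degree `d` with its `d - 1` outer
edges decorated by `n` sites each. -/
def transferL (d n : ℕ) : Matrix (Fin 2) (Fin 2) ℂ →ₗ[ℂ] SpinMat (d - 1) :=
  (tensorPower (d - 1) siteTransfer ^ n) ∘ₗ krausMap d (wLeft d)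

/-- The transfer operator `𝔼_R^{(d,n)}` of a right vertex of degree `d` with its `d - 1` outer
edges decorated by `n` sites each. -/
def transferR (d n : ℕ) : SpinMat (d - 1) →ₗ[ℂ] Matrix (Fin 2) (Fin 2) ℂ :=
  krausMap d (wRight d) ∘ₗ (tensorPower (d - 1) siteTransfer ^ n)

/-- `Q_L^{(d,n)} = 𝔼_L^{(d,n)}(𝟙)`. -/
def QL (d n : ℕ) : SpinMat (d - 1) := transferL d n 1

/-- `Q_R^{(d,n)} = (𝔼_R^{(d,n)})*(ρ)`. -/
def QR (d n : ℕ) : SpinMat (d - 1) := hsAdjoint (transferR d n) rho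

/-- The minimal eigenvalue `q_L^{(d,n)}` of `Q_L^{(d,n)}`. -/
def qL (d n : ℕ) : ℝ := minEigenvalue (QL d n)

/-- The minimal eigenvalue `q_R^{(d,n)}` of `Q_R^{(d,n)}`. -/
def qR (d n : ℕ) : ℝ := minEigenvalue (QR d n)

/-- `b_L^∞ = 4 a(n) ‖𝔼_L‖_∞ / q_L`. -/
def bLInfty (d n : ℕ) : ℝ := 4 * rate n * schattenInfty (transferL d n) / qL d n

/-- `b_R^∞ = 2 a(n) ‖𝔼_R‖_∞ / q_R`. -/
def bRInfty (d n : ℕ) : ℝ := 2 * rate n * schattenInfty (transferR d n) / qR d n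

/-- `b_LR^∞ = b_L^∞ b_R^∞ / (4 a(n))`, for vertices of degrees `dL` and `dR`. -/
def bLRInfty (dL dR n : ℕ) : ℝ := bLInfty dL n * bRInfty dR n / (4 * rate n)

/-- The bound `δ^∞` for an edge between vertices of degrees `dL` and `dR`. -/
def deltaInfty (dL dR n : ℕ) : ℝ :=
  4 * rate n *
    (1 / √((1 - bLInfty dL n) * (1 - bRInfty dR n)) +
      (4 * rate n + bLInfty dL n * bRInfty dR n) / ((1 - bLInfty dL n) * (1 - bRInfty dR n)))

/-- `b_L^op = 8 a(n) ‖𝔼_L‖_op / q_L`. -/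
def bLOp (d n : ℕ) : ℝ := 8 * rate n * inducedOpNorm (transferL d n) / qL d n

/-- `b_R^op = 4 a(n) ‖𝔼_R‖_op / q_R`. -/
def bROp (d n : ℕ) : ℝ := 4 * rate n * inducedOpNorm (transferR d n) / qR d n

/-- `b_LR^op = b_L^op b_R^op / (8 a(n))`, for vertices of degrees `dL` and `dR`. -/
def bLROp (dL dR n : ℕ) : ℝ := bLOp dL n * bROp dR n / (8 * rate n)

/-- The bound `δ^op` for an edge between vertices of degrees `dL` and `dR`. -/
def deltaOp (dL dR n : ℕ) : ℝ :=
  4 * rate n *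
    (1 / √((1 - bLOp dL n) * (1 - bROp dR n)) +
      4 * rate n * (1 + bLROp dL dR n) / ((1 - bLOp dL n) * (1 - bROp dR n)))

end AKLT

end

noncomputable section

open scoped ComplexOrder Pointwise

set_option linter.unusedSectionVars false

namespace AKLT

/-! ### Norms of matrices and of maps between matrix algebras. -/

section Norms

variable {p q r : Type} [Fintype p] [DecidableEq p] [Fintype q] [DecidableEq q]
  [Fintype r] [DecidableEq r]

/-! Both transfer operators are completely positive, so the Kadison–Schwarz inequality bounds their
Schatten norms by data that the induced operator norms dominate. Write a for `rate n`, Q for `QL d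
n`, q for its least eigenvalue and c = (d+1)/2.

On the left, E_L(1) = Q and E_L multiplies traces by c. On the right, E_R(1) = c·1 and Tr E_R(A) =
Tr(AQ). Taking the trace in Kadison–Schwarz (`IsCompletelyPositive.hsNorm_sq_le`) bounds both
squared Schatten norms by c‖Q‖. Evaluating at 1 gives ‖E_L‖_op ≥ ‖Q‖ and ‖E_R‖_op ≥ c. Moreover Q_R
= Q/2, so q_R = q/2.

Put t = 16a²c‖Q‖/q² (`bSqBound`). Then (b_L^∞)² ≤ t, (b_R^∞)² ≤ t and b_L^op b_R^op ≥ 4t. The three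
claims follow from these bounds, together with t > 0, by elementary inequalities and AM–GM
(`one_sub_mul_one_sub_lt`).

The bound on n serves only to give n ≥ 1. One application of the transfer operator already makes Q
positive definite (`posDef_tensorPower_siteTransfer`), hence q > 0. Regularity of the graph lets
both endpoints share the same Q. -/

theorem hsNorm_nonneg (A : Matrix p p ℂ) : 0 ≤ hsNorm A := Real.sqrt_nonneg _

theorem re_trace_conjTranspose_mul_self (A : Matrix p q ℂ) :
    (Aᴴ * A).trace.re = ∑ j, ∑ i, ‖A i j‖ ^ 2 := by
  simp only [Matrix.trace, Matrix.diag_apply, Matrix.mul_apply, Matrix.conjTranspose_apply,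
    Complex.re_sum]
  refine Finset.sum_congr rfl fun j _ => Finset.sum_congr rfl fun i _ => ?_
  rw [Complex.sq_norm, Complex.normSq_apply]
  simp

theorem hsNorm_sq (A : Matrix p p ℂ) : hsNorm A ^ 2 = (Aᴴ * A).trace.re := by
  rw [re_trace_conjTranspose_mul_self, hsNorm, Real.sq_sqrt (by positivity), Finset.sum_comm]

theorem hsNorm_pos {A : Matrix p p ℂ} (hA : A ≠ 0) : 0 < hsNorm A := by
  refine (hsNorm_nonneg A).lt_of_ne' fun h => hA ?_
  rw [hsNorm, Real.sqrt_eq_zero (by positivity),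
    Finset.sum_eq_zero_iff_of_nonneg (fun i _ => by positivity)] at h
  ext i j
  have := (Finset.sum_eq_zero_iff_of_nonneg (fun j _ => by positivity)).1
    (h i (Finset.mem_univ i)) j (Finset.mem_univ j)
  simpa using this

theorem hsNorm_smul (c : ℂ) (A : Matrix p p ℂ) : hsNorm (c • A) = ‖c‖ * hsNorm A := by
  simp only [hsNorm, Matrix.smul_apply, smul_eq_mul, norm_mul, mul_pow, ← Finset.mul_sum]
  rw [Real.sqrt_mul (by positivity), Real.sqrt_sq (norm_nonneg c)]

section

open scoped Matrix.Norms.Frobenius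

theorem hsNorm_eq_frobenius (A : Matrix p p ℂ) : hsNorm A = ‖A‖ := by
  rw [Matrix.frobenius_norm_def, hsNorm, Real.sqrt_eq_rpow]
  simp

/-- A real `sSup` of an unbounded set is 0 by default, so lower bounds on `schattenInfty` need this.
-/
theorem bddAbove_hsNorm_ratio (T : Matrix p p ℂ →ₗ[ℂ] Matrix q q ℂ) :
    BddAbove {x : ℝ | ∃ A : Matrix p p ℂ, A ≠ 0 ∧ x = hsNorm (T A) / hsNorm A} := by
  refine ⟨∑ i, ∑ j, ‖T (Matrix.single i j 1)‖, ?_⟩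
  rintro _ ⟨A, hA, rfl⟩
  rw [div_le_iff₀ (hsNorm_pos hA), hsNorm_eq_frobenius]
  have hT : T A = ∑ i, ∑ j, A i j • T (Matrix.single i j 1) := by
    conv_lhs => rw [Matrix.matrix_eq_sum_single A]
    simp only [map_sum]
    refine Finset.sum_congr rfl fun i _ => Finset.sum_congr rfl fun j _ => ?_
    rw [← map_smul, Matrix.smul_single, smul_eq_mul, mul_one]
  rw [hT, Finset.sum_mul]
  refine (norm_sum_le _ _).trans (Finset.sum_le_sum fun i _ => ?_)
  rw [Finset.sum_mul]
  refine (norm_sum_le _ _).trans (Finset.sum_le_sum fun j _ => ?_)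
  rw [norm_smul, mul_comm]
  refine mul_le_mul_of_nonneg_left ?_ (norm_nonneg _)
  refine Real.le_sqrt_of_sq_le ?_
  exact (Finset.single_le_sum (f := fun j => ‖A i j‖ ^ 2) (fun _ _ => by positivity)
    (Finset.mem_univ j)).trans (Finset.single_le_sum (f := fun i => ∑ j, ‖A i j‖ ^ 2)
      (fun _ _ => by positivity) (Finset.mem_univ i))

end

theorem schattenInfty_nonneg (T : Matrix p p ℂ →ₗ[ℂ] Matrix q q ℂ) : 0 ≤ schattenInfty T := by
  refine Real.sSup_nonneg ?_
  rintro _ ⟨A, -, rfl⟩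
  exact div_nonneg (hsNorm_nonneg _) (hsNorm_nonneg _)

theorem le_schattenInfty (T : Matrix p p ℂ →ₗ[ℂ] Matrix q q ℂ) {A : Matrix p p ℂ} (hA : A ≠ 0) :
    hsNorm (T A) / hsNorm A ≤ schattenInfty T :=
  le_csSup (bddAbove_hsNorm_ratio T) ⟨A, hA, rfl⟩

section

open scoped Matrix.Norms.L2Operator

theorem opNorm_eq_l2 (A : Matrix p p ℂ) : opNorm A = ‖A‖ := rfl

theorem le_inducedOpNorm (T : Matrix p p ℂ →ₗ[ℂ] Matrix q q ℂ) {A : Matrix p p ℂ} (hA : A ≠ 0) :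
    opNorm (T A) / opNorm A ≤ inducedOpNorm T := by
  refine le_csSup ⟨‖T.toContinuousLinearMap‖, ?_⟩ ⟨A, hA, rfl⟩
  rintro _ ⟨B, hB, rfl⟩
  rw [opNorm_eq_l2, opNorm_eq_l2, div_le_iff₀ (norm_pos_iff.2 hB)]
  exact T.toContinuousLinearMap.le_opNorm B

theorem opNorm_nonneg (A : Matrix p p ℂ) : 0 ≤ opNorm A := norm_nonneg _

theorem opNorm_pos {A : Matrix p p ℂ} (hA : A ≠ 0) : 0 < opNorm A := by
  rw [opNorm_eq_l2]
  exact norm_pos_iff.2 hA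

theorem opNorm_smul (c : ℂ) (A : Matrix p p ℂ) : opNorm (c • A) = ‖c‖ * opNorm A := norm_smul c A

theorem opNorm_one [Nonempty p] : opNorm (1 : Matrix p p ℂ) = 1 := by
  rw [opNorm_eq_l2]
  exact CStarRing.norm_one

theorem opNorm_map_one_le_inducedOpNorm [Nonempty p] (T : Matrix p p ℂ →ₗ[ℂ] Matrix q q ℂ) :
    opNorm (T 1) ≤ inducedOpNorm T := by
  simpa [opNorm_one] using le_inducedOpNorm T (one_ne_zero (α := Matrix p p ℂ))

/-- Apply the operator norm bound to each column of B. Rectangular shapes are needed for stacked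
Kraus operators. -/
theorem re_trace_mul_le (M : Matrix p q ℂ) (B : Matrix q r ℂ) :
    ((M * B)ᴴ * (M * B)).trace.re ≤ ‖M‖ ^ 2 * (Bᴴ * B).trace.re := by
  rw [re_trace_conjTranspose_mul_self, re_trace_conjTranspose_mul_self, Finset.mul_sum]
  refine Finset.sum_le_sum fun j _ => ?_
  have h := Matrix.l2_opNorm_mulVec M (WithLp.toLp 2 fun i => B i j)
  have h2 := pow_le_pow_left₀ (norm_nonneg _) h 2
  rw [mul_pow, EuclideanSpace.norm_sq_eq, EuclideanSpace.norm_sq_eq] at h2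
  simpa [Matrix.mulVec, dotProduct, Matrix.mul_apply] using h2

theorem re_trace_mul_conjTranspose_mul_le (M A : Matrix p p ℂ) :
    (M * (Aᴴ * A)).trace.re ≤ opNorm M * hsNorm A ^ 2 := by
  -- By cyclicity the trace is Tr(A M A*), a sum of quadratic forms of M at the columns of A*;
  -- Cauchy–Schwarz bounds each one.
  have key : (M * (Aᴴ * A)).trace =
      ∑ j, inner ℂ (WithLp.toLp 2 fun i => Aᴴ i j)
        (WithLp.toLp 2 (M *ᵥ (fun i => Aᴴ i j)) : EuclideanSpace ℂ p) := by
    rw [← Matrix.mul_assoc, Matrix.trace_mul_comm, Matrix.trace]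
    refine Finset.sum_congr rfl fun j _ => ?_
    simp [Matrix.mul_apply, PiLp.inner_apply, Matrix.mulVec, dotProduct, mul_comm]
  have hA : hsNorm A ^ 2 = ∑ j, ‖(WithLp.toLp 2 fun i => Aᴴ i j : EuclideanSpace ℂ p)‖ ^ 2 := by
    rw [hsNorm, Real.sq_sqrt (by positivity)]
    simp [EuclideanSpace.norm_sq_eq]
  rw [key, hA, Complex.re_sum, Finset.mul_sum]
  refine Finset.sum_le_sum fun j _ => ?_
  refine (Complex.re_le_norm _).trans ((norm_inner_le_norm _ _).trans ?_)
  have := Matrix.l2_opNorm_mulVec M (WithLp.toLp 2 fun i => Aᴴ i j)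
  calc _ ≤ _ * (‖M‖ * _) := mul_le_mul_of_nonneg_left this (norm_nonneg _)
    _ = _ := by rw [opNorm_eq_l2]; ring

end

/-! ### Complete positivity and the Kadison–Schwarz inequality. -/

/-- Complete positivity of a map of matrix algebras, in Kraus form. -/
def IsCompletelyPositive (T : Matrix p p ℂ →ₗ[ℂ] Matrix q q ℂ) : Prop :=
  ∃ (ι : Type) (_ : Fintype ι) (K : ι → Matrix p q ℂ), ∀ A, T A = ∑ i, (K i)ᴴ * A * K i

theorem IsCompletelyPositive.comp {S : Matrix q q ℂ →ₗ[ℂ] Matrix r r ℂ}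
    {T : Matrix p p ℂ →ₗ[ℂ] Matrix q q ℂ} (hS : IsCompletelyPositive S)
    (hT : IsCompletelyPositive T) : IsCompletelyPositive (S ∘ₗ T) := by
  obtain ⟨ι, _, K, hK⟩ := hS
  obtain ⟨κ, _, L, hL⟩ := hT
  refine ⟨ι × κ, inferInstance, fun x => L x.2 * K x.1, fun A => ?_⟩
  rw [LinearMap.comp_apply, hK, hL, Fintype.sum_prod_type]
  refine Finset.sum_congr rfl fun i _ => ?_
  simp only [Matrix.mul_sum, Matrix.sum_mul, Matrix.conjTranspose_mul, Matrix.mul_assoc]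

theorem IsCompletelyPositive.pow {T : Module.End ℂ (Matrix p p ℂ)} (hT : IsCompletelyPositive T)
    (n : ℕ) : IsCompletelyPositive (T ^ n) := by
  induction n with
  | zero => exact ⟨Unit, inferInstance, fun _ => 1, fun A => by simp⟩
  | succ n ih => exact IsCompletelyPositive.comp ih hT

theorem isCompletelyPositive_krausMap (d : ℕ) (W : ℕ → Matrix p q ℂ) :
    IsCompletelyPositive (krausMap d W) :=
  ⟨Fin (d + 1), inferInstance, fun k => W k, fun A => by
    simp only [krausMap, LinearMap.coe_mk, AddHom.coe_mk]
    rw [Finset.sum_range]⟩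

theorem IsCompletelyPositive.posSemidef {T : Matrix p p ℂ →ₗ[ℂ] Matrix q q ℂ}
    (hT : IsCompletelyPositive T) {A : Matrix p p ℂ} (hA : A.PosSemidef) :
    (T A).PosSemidef := by
  obtain ⟨ι, _, K, hK⟩ := hT
  rw [hK]
  exact Matrix.posSemidef_sum _ fun i _ => hA.conjTranspose_mul_mul_same _

/-- The matrices of a family stacked on top of each other. -/
def stack {ι : Type} (M : ι → Matrix p q ℂ) : Matrix (p × ι) q ℂ := Matrix.of fun x b => M x.2 x.1 b

theorem conjTranspose_stack_mul_stack {ι : Type} [Fintype ι] (M N : ι → Matrix p q ℂ) :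
    (stack M)ᴴ * stack N = ∑ i, (M i)ᴴ * N i := by
  ext a b
  simp [stack, Matrix.mul_apply, Matrix.sum_apply, Fintype.sum_prod_type_right]

open scoped Matrix.Norms.L2Operator in
/-- The Kadison–Schwarz inequality, after taking the trace. -/
theorem IsCompletelyPositive.hsNorm_sq_le {T : Matrix p p ℂ →ₗ[ℂ] Matrix q q ℂ}
    (hT : IsCompletelyPositive T) (A : Matrix p p ℂ) :
    hsNorm (T A) ^ 2 ≤ opNorm (T 1) * (T (Aᴴ * A)).trace.re := by
  obtain ⟨ι, _, K, hK⟩ := hT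
  classical
  -- With S the stack of the K i and R the stack of the A K i, one has T(1) = S*S, T(A) = S*R and
  -- T(A*A) = R*R. The claim becomes ‖S*R‖₂² ≤ ‖S‖²‖R‖₂².
  have h1 : T 1 = (stack K)ᴴ * stack K := by
    rw [conjTranspose_stack_mul_stack, hK]
    simp
  have h2 : T A = (stack K)ᴴ * stack (fun i => A * K i) := by
    rw [conjTranspose_stack_mul_stack, hK]
    simp only [Matrix.mul_assoc]
  have h3 : T (Aᴴ * A) = (stack fun i => A * K i)ᴴ * stack fun i => A * K i := by
    rw [conjTranspose_stack_mul_stack, hK]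
    simp only [Matrix.mul_assoc, Matrix.conjTranspose_mul]
  rw [hsNorm_sq, h3, opNorm_eq_l2, h1, h2, Matrix.l2_opNorm_conjTranspose_mul_self, ← pow_two,
    ← Matrix.l2_opNorm_conjTranspose (stack K)]
  exact re_trace_mul_le _ _

/-- The constant c will be (d+1)/2 for the left operator and `opNorm (QL d n)` for the right one. -/
theorem IsCompletelyPositive.schattenInfty_sq_le {T : Matrix p p ℂ →ₗ[ℂ] Matrix q q ℂ}
    (hT : IsCompletelyPositive T) {c : ℝ} (hc : 0 ≤ c)
    (h : ∀ A, (T (Aᴴ * A)).trace.re ≤ c * hsNorm A ^ 2) :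
    schattenInfty T ^ 2 ≤ opNorm (T 1) * c := by
  have hnn : 0 ≤ opNorm (T 1) * c := mul_nonneg (opNorm_nonneg _) hc
  suffices schattenInfty T ≤ √(opNorm (T 1) * c) by
    simpa [Real.sq_sqrt hnn] using pow_le_pow_left₀ (schattenInfty_nonneg T) this 2
  refine Real.sSup_le ?_ (Real.sqrt_nonneg _)
  rintro _ ⟨A, hA, rfl⟩
  refine Real.le_sqrt_of_sq_le ?_
  rw [div_pow, div_le_iff₀ (pow_pos (hsNorm_pos hA) 2), mul_assoc]
  exact (hT.hsNorm_sq_le A).trans (mul_le_mul_of_nonneg_left (h A) (opNorm_nonneg _))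

theorem minEigenvalue_pos [Nonempty p] {A : Matrix p p ℂ} (hA : A.PosDef) :
    0 < minEigenvalue A := by
  have hs := hA.isHermitian.spectrum_real_eq_range_eigenvalues
  have hne : (spectrum ℝ A).Nonempty := hs ▸ Set.range_nonempty _
  have hfin : (spectrum ℝ A).Finite := hs ▸ Set.finite_range _
  -- A finite nonempty spectrum attains its infimum, so the `sInf` is a genuine eigenvalue.
  have hmem := hne.csInf_mem hfin
  rw [hs] at hmem
  obtain ⟨i, hi⟩ := hmem
  rw [← hs] at hi
  rw [minEigenvalue, ← hi]
  exact hA.eigenvalues_pos i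

theorem minEigenvalue_smul {A : Matrix p p ℂ} {c : ℝ} (hc : 0 < c) :
    minEigenvalue (c • A) = c * minEigenvalue A := by
  have := spectrum.unit_smul_eq_smul (R := ℝ) A (Units.mk0 c hc.ne')
  rw [Units.smul_def, Units.val_mk0, Units.smul_def, Units.val_mk0] at this
  rw [minEigenvalue, this]
  exact Real.sInf_smul_of_nonneg hc.le _

end Norms

/-! ### Tensor powers of maps on 2 × 2 matrices. -/

section TensorPower

/-- Tensor products of Kraus operators are Kraus operators of the tensor power: expand the product
over sites of the sums over c. -/
theorem tensorPower_eq_sum {ι : Type} [Fintype ι] (m : ℕ)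
    {T : Module.End ℂ (Matrix (Fin 2) (Fin 2) ℂ)} {K : ι → Matrix (Fin 2) (Fin 2) ℂ}
    (hK : ∀ A, T A = ∑ c, (K c)ᴴ * A * K c) (A : SpinMat m) :
    tensorPower m T A =
      ∑ f : Fin m → ι, (pureTensor fun i => K (f i))ᴴ * A * pureTensor fun i => K (f i) := by
  classical
  have hT : ∀ a b s t, T (Matrix.single a b 1) s t = ∑ c, star (K c a s) * K c b t := by
    intro a b s t
    rw [hK, Matrix.sum_apply]
    refine Finset.sum_congr rfl fun c _ => ?_
    rw [Matrix.mul_apply, Finset.sum_eq_single b]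
    · simp
    · intro x _ hx
      rw [Matrix.mul_single_apply_of_ne _ _ _ _ _ hx]
      simp
    · simp
  ext s t
  simp only [tensorPower, LinearMap.coe_mk, AddHom.coe_mk, Matrix.of_apply, hT, Matrix.sum_apply,
    Finset.prod_univ_sum, Fintype.piFinset_univ, Finset.mul_sum]
  rw [Finset.sum_comm]
  simp_rw [Finset.sum_comm (t := (Finset.univ : Finset (Fin m → ι)))]
  refine Finset.sum_congr rfl fun f _ => ?_
  simp only [Matrix.mul_apply, Matrix.conjTranspose_apply, pureTensor, Matrix.of_apply,
    Finset.sum_mul, star_prod, Finset.prod_mul_distrib]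
  refine Finset.sum_congr rfl fun v _ => Finset.sum_congr rfl fun u _ => ?_
  ring

theorem IsCompletelyPositive.tensorPower (m : ℕ) {T : Module.End ℂ (Matrix (Fin 2) (Fin 2) ℂ)}
    (hT : IsCompletelyPositive T) : IsCompletelyPositive (tensorPower m T) := by
  obtain ⟨ι, _, K, hK⟩ := hT
  classical
  exact ⟨Fin m → ι, inferInstance, _, tensorPower_eq_sum m hK⟩

/-- The hypothesis is symmetry of T for the bilinear form Tr(AB), tested on matrix units; symmetry
passes to each tensor factor. -/
theorem trace_tensorPower_mul (m : ℕ) {T : Module.End ℂ (Matrix (Fin 2) (Fin 2) ℂ)}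
    (hT : ∀ a b s t, T (Matrix.single a b 1) s t = T (Matrix.single t s 1) b a)
    (A B : SpinMat m) : (tensorPower m T A * B).trace = (A * tensorPower m T B).trace := by
  simp only [Matrix.trace, Matrix.diag_apply, Matrix.mul_apply, tensorPower, LinearMap.coe_mk,
    AddHom.coe_mk, Matrix.of_apply, Finset.sum_mul, Finset.mul_sum]
  have h : ∀ F G : Conf m → Conf m → Conf m → Conf m → ℂ, (∀ s t u v, F s t u v = G u v t s) →
      ∑ s, ∑ t, ∑ u, ∑ v, F s t u v = ∑ u, ∑ v, ∑ t, ∑ s, G u v t s := by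
    intro F G hFG
    let e : Conf m × Conf m × Conf m × Conf m ≃ Conf m × Conf m × Conf m × Conf m :=
      { toFun := fun x => (x.2.2.1, x.2.2.2, x.2.1, x.1)
        invFun := fun x => (x.2.2.2, x.2.2.1, x.1, x.2.1)
        left_inv := fun _ => rfl
        right_inv := fun _ => rfl }
    have := Fintype.sum_equiv e (fun x => F x.1 x.2.1 x.2.2.1 x.2.2.2)
      (fun x => G x.1 x.2.1 x.2.2.1 x.2.2.2) fun x => hFG _ _ _ _
    simpa only [Fintype.sum_prod_type] using this
  refine h _ _ fun s t u v => ?_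
  rw [Finset.prod_congr rfl fun i _ => hT (u i) (v i) (s i) (t i)]
  ring

theorem tensorPower_one (m : ℕ) {T : Module.End ℂ (Matrix (Fin 2) (Fin 2) ℂ)} (hT : T 1 = 1) :
    tensorPower m T 1 = 1 := by
  have h1 : (1 : SpinMat m) = pureTensor fun _ => 1 := by
    ext s t
    simp only [pureTensor, Matrix.of_apply, Matrix.one_apply, Finset.prod_ite_zero, funext_iff]
    simp
  rw [h1, tensorPower_pureTensor, hT]

end TensorPower

/-! ### The AKLT transfer operator: positivity, symmetry, convergence rate. -/

section SiteTransfer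

theorem siteTransfer_apply (A : Matrix (Fin 2) (Fin 2) ℂ) :
    siteTransfer A = !![(A 0 0 + 2 * A 1 1) / 3, -A 0 1 / 3; -A 1 0 / 3,
      (2 * A 0 0 + A 1 1) / 3] := by
  ext i j
  fin_cases i <;> fin_cases j <;>
    simp [siteTransfer, ketBra, hsInner, rho, spin, pauli, Fin.sum_univ_three, Matrix.trace,
      Matrix.mul_apply, Fin.sum_univ_two] <;>
    ring_nf <;> simp <;> ring

theorem siteTransfer_one : siteTransfer 1 = 1 := by
  rw [siteTransfer_apply]
  ext i j
  fin_cases i <;> fin_cases j <;> norm_num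

theorem siteTransfer_symm (a b s t : Fin 2) :
    siteTransfer (Matrix.single a b 1) s t = siteTransfer (Matrix.single t s 1) b a := by
  rw [siteTransfer_apply, siteTransfer_apply]
  fin_cases a <;> fin_cases b <;> fin_cases s <;> fin_cases t <;> simp [Matrix.single]

/-- Kraus operators of the transfer operator: the two ladder operators and the diagonal one. -/
def ladder : Fin 3 → Matrix (Fin 2) (Fin 2) ℂ :=
  ![(√(2 / 3) : ℂ) • Matrix.single 1 0 1, (√(2 / 3) : ℂ) • Matrix.single 0 1 1,
    (√(1 / 3) : ℂ) • !![1, 0; 0, -1]]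

theorem siteTransfer_eq_sum_ladder (A : Matrix (Fin 2) (Fin 2) ℂ) :
    siteTransfer A = ∑ c, (ladder c)ᴴ * A * ladder c := by
  have h2 : ((√(2 / 3) : ℝ) : ℂ) * ((√(2 / 3) : ℝ) : ℂ) = 2 / 3 := by
    rw [← Complex.ofReal_mul, Real.mul_self_sqrt (by norm_num)]; norm_num
  have h1 : ((√(1 / 3) : ℝ) : ℂ) * ((√(1 / 3) : ℝ) : ℂ) = 1 / 3 := by
    rw [← Complex.ofReal_mul, Real.mul_self_sqrt (by norm_num)]; norm_num
  rw [siteTransfer_apply]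
  simp only [Fin.sum_univ_three, ladder, Matrix.cons_val, Matrix.conjTranspose_smul,
    Matrix.smul_mul, Matrix.mul_smul, smul_smul, Complex.star_def, Complex.conj_ofReal, h1, h2]
  ext i j
  fin_cases i <;> fin_cases j <;>
    simp [Matrix.mul_apply, Fin.sum_univ_two, Matrix.single] <;> ring

theorem isCompletelyPositive_siteTransfer : IsCompletelyPositive siteTransfer :=
  ⟨Fin 3, inferInstance, ladder, siteTransfer_eq_sum_ladder⟩

/-- `castSucc` selects the two off-diagonal Kraus operators. Their tensor products are multiples of
the matrix units from s to the flipped configuration. -/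
theorem pureTensor_ladder {m : ℕ} (s : Conf m) :
    (pureTensor fun i => ladder (s i).castSucc) =
      Matrix.single (fun i => (s i).rev) s ((√(2 / 3) : ℂ) ^ m) := by
  have hl : ∀ a u v : Fin 2, ladder a.castSucc u v =
      if a.rev = u ∧ a = v then (√(2 / 3) : ℂ) else 0 := by
    intro a u v
    fin_cases a <;> fin_cases u <;> fin_cases v <;> simp [ladder, Matrix.single, Fin.rev]
  ext u v
  simp only [pureTensor, Matrix.of_apply, hl, Finset.prod_ite_zero, Matrix.single, funext_iff,
    ← forall_and]
  simp only [Finset.mem_univ, forall_const, Finset.prod_const, Finset.card_univ, Fintype.card_fin]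

/-- If x s ≠ 0, the Kraus term of `pureTensor_ladder s` contributes a positive multiple of |x s|²
times a diagonal entry of A; all other terms are nonnegative. -/
theorem posDef_tensorPower_siteTransfer {m : ℕ} {A : SpinMat m} (hA : A.PosSemidef)
    (hd : ∀ s, 0 < A s s) : (tensorPower m siteTransfer A).PosDef := by
  have hcp := isCompletelyPositive_siteTransfer.tensorPower m
  refine .of_dotProduct_mulVec_pos (hcp.posSemidef hA).1 fun x hx => ?_
  obtain ⟨s, hs⟩ := Function.ne_iff.1 hx
  have hterm : ∀ M : SpinMat m, star x ⬝ᵥ ((Mᴴ * A * M) *ᵥ x) =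
      star (M *ᵥ x) ⬝ᵥ (A *ᵥ (M *ᵥ x)) := by
    intro M
    simp only [Matrix.star_mulVec, Matrix.dotProduct_mulVec, Matrix.vecMul_vecMul,
      Matrix.mul_assoc]
  rw [tensorPower_eq_sum m siteTransfer_eq_sum_ladder, Matrix.sum_mulVec, dotProduct_sum]
  refine Finset.sum_pos' (fun f _ => ?_) ⟨fun i => (s i).castSucc, Finset.mem_univ _, ?_⟩
  · rw [hterm]
    exact hA.dotProduct_mulVec_nonneg _
  · rw [hterm, pureTensor_ladder, Matrix.single_mulVec]
    set z : ℂ := (√(2 / 3) : ℂ) ^ m * x s with hz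
    have hz0 : z ≠ 0 := mul_ne_zero (pow_ne_zero _ (by simp)) hs
    have hu : Function.update (0 : Conf m → ℂ) (fun i => (s i).rev) z =
        Pi.single (fun i => (s i).rev) z := rfl
    rw [hu, Pi.star_single, single_dotProduct, Matrix.mulVec_single]
    have hz1 : (0 : ℂ) < z * star z := by
      rw [Complex.star_def, Complex.mul_conj]
      exact_mod_cast Complex.normSq_pos.2 hz0
    refine (mul_pos (hd fun i => (s i).rev) hz1).trans_eq ?_
    simp only [Pi.smul_apply, Matrix.col_apply, MulOpposite.smul_eq_mul_unop, MulOpposite.unop_op]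
    ring

theorem posDef_tensorPower_siteTransfer_pow {m n : ℕ} (hn : n ≠ 0) {A : SpinMat m}
    (hA : A.PosSemidef) (hd : ∀ s, 0 < A s s) :
    ((tensorPower m siteTransfer ^ n) A).PosDef := by
  induction n with
  | zero => exact absurd rfl hn
  | succ n ih =>
    rw [pow_succ', Module.End.mul_apply]
    rcases eq_or_ne n 0 with rfl | h
    · exact posDef_tensorPower_siteTransfer hA hd
    · exact posDef_tensorPower_siteTransfer (ih h).posSemidef fun s => (ih h).diag_pos

theorem trace_tensorPower_siteTransfer_pow_mul (m n : ℕ) (A B : SpinMat m) :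
    ((tensorPower m siteTransfer ^ n) A * B).trace =
      (A * (tensorPower m siteTransfer ^ n) B).trace := by
  induction n generalizing A with
  | zero => rfl
  | succ n ih =>
    rw [pow_succ, Module.End.mul_apply, ih, trace_tensorPower_mul m siteTransfer_symm,
      ← Module.End.mul_apply, ← pow_succ', pow_succ]

theorem tensorPower_siteTransfer_pow_one (m n : ℕ) :
    (tensorPower m siteTransfer ^ n) 1 = 1 := by
  induction n with
  | zero => rfl
  | succ n ih => rw [pow_succ', Module.End.mul_apply, ih, tensorPower_one m siteTransfer_one]

theorem trace_tensorPower_siteTransfer_pow (m n : ℕ) (A : SpinMat m) :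
    ((tensorPower m siteTransfer ^ n) A).trace = A.trace := by
  simpa [tensorPower_siteTransfer_pow_one] using trace_tensorPower_siteTransfer_pow_mul m n A 1

/-- The matrix σ^Z is an eigenvector of the transfer operator with eigenvalue -1/3 and is
annihilated by |1⟩⟨ρ|, so the rate is at least 3⁻ⁿ. -/
theorem rate_pos (n : ℕ) : 0 < rate n := by
  have hZ : siteTransfer (pauli 2) = (-1 / 3 : ℂ) • pauli 2 := by
    rw [siteTransfer_apply]
    ext i j
    fin_cases i <;> fin_cases j <;> simp [pauli] <;> ring
  have hZn : (siteTransfer ^ n) (pauli 2) = ((-1 / 3 : ℂ) ^ n) • pauli 2 := by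
    induction n with
    | zero => simp
    | succ n ih => rw [pow_succ', Module.End.mul_apply, ih, map_smul, hZ, smul_smul, pow_succ]
  have h0 : ketBra 1 rho (pauli 2) = (0 : Matrix (Fin 2) (Fin 2) ℂ) := by
    simp [ketBra, hsInner, rho, pauli]
  have hne : pauli 2 ≠ 0 := fun h => by simpa [pauli] using congrFun (congrFun h 0) 0
  refine lt_of_lt_of_le ?_ (le_schattenInfty _ hne)
  rw [LinearMap.sub_apply, h0, sub_zero, hZn, hsNorm_smul]
  have := hsNorm_pos hne
  have : (0 : ℝ) < ‖(-1 / 3 : ℂ) ^ n‖ := norm_pos_iff.2 (pow_ne_zero _ (by norm_num))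
  positivity

end SiteTransfer

/-! ### Symmetric vectors, vertex tensors and their Gram operators. -/

/-- The number of spins up in a configuration. -/
def ups {m : ℕ} (s : Conf m) : ℕ := (Finset.univ.filter fun i => s i = 0).card

theorem ups_le {m : ℕ} (s : Conf m) : ups s ≤ m := by
  simpa [ups] using Finset.card_filter_le Finset.univ fun i => s i = 0

theorem card_ups_eq (m k : ℕ) : (Finset.univ.filter fun s : Conf m => ups s = k).card =
    m.choose k := by
  have h := Finset.card_powersetCard k (Finset.univ : Finset (Fin m))
  rw [Finset.card_univ, Fintype.card_fin] at h
  rw [← h]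
  refine Finset.card_bij' (fun s _ => Finset.univ.filter fun i => s i = 0)
    (fun u _ i => if i ∈ u then 0 else 1) ?_ ?_ ?_ ?_
  · intro s hs
    have := (Finset.mem_filter.1 hs).2
    exact Finset.mem_powersetCard.2 ⟨Finset.subset_univ _, this⟩
  · intro u hu
    refine Finset.mem_filter.2 ⟨Finset.mem_univ _, ?_⟩
    simpa [ups] using (Finset.mem_powersetCard.1 hu).2
  · intro s _
    ext i
    have : s i = 0 ∨ s i = 1 := by omega
    rcases this with h | h <;> simp [h]
  · intro u _
    ext i
    simp

theorem ups_rev {m : ℕ} (s : Conf m) : ups (fun i => (s i).rev) = m - ups s := by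
  have h : ∀ a : Fin 2, a.rev = 0 ↔ ¬ a = 0 := by decide
  have := Finset.card_filter_add_card_filter_not (s := (Finset.univ : Finset (Fin m)))
    (fun i => s i = 0)
  simp only [ups, h]
  simp only [Finset.card_univ, Fintype.card_fin] at this
  omega

theorem symVec_mul_symVec (m k l : ℕ) (s t : Conf m) : symVec m k s * symVec m l t =
    if ups s = k ∧ ups t = l then
      (((1 / √(m.choose k : ℝ)) * (1 / √(m.choose l : ℝ)) : ℝ) : ℂ) else 0 := by
  simp only [symVec, ups]
  split_ifs <;> simp_all

theorem star_symVec (m k : ℕ) : star (symVec m k) = symVec m k := by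
  ext s
  simp only [symVec, Pi.star_apply]
  split_ifs <;> simp

theorem symVec_mul_self (m k : ℕ) (s t : Conf m) : symVec m k s * symVec m k t =
    if ups s = k ∧ ups t = k then ((m.choose k : ℂ))⁻¹ else 0 := by
  rw [symVec_mul_symVec]
  congr 1
  rw [div_mul_div_comm, Real.mul_self_sqrt (by positivity)]
  simp

theorem sum_symVec_sq {m k : ℕ} (hk : k ≤ m) : ∑ s, symVec m k s * symVec m k s = 1 := by
  simp only [symVec_mul_self, and_self]
  rw [Finset.sum_ite, Finset.sum_const_zero, Finset.sum_const, card_ups_eq, add_zero, nsmul_eq_mul,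
    mul_inv_cancel₀]
  exact_mod_cast (Nat.choose_pos hk).ne'

theorem sum_symVec_mul_of_ne {m k l : ℕ} (h : k ≠ l) :
    ∑ s, symVec m k s * symVec m l s = 0 := by
  refine Finset.sum_eq_zero fun s _ => ?_
  rw [symVec_mul_symVec, if_neg]
  rintro ⟨rfl, rfl⟩
  exact h rfl

/-- The weight of `φ_k` in `V_k`. -/
def weightDown (d k : ℕ) : ℝ := √(((d : ℝ) - k) / d)

/-- The weight of `φ_{k-1}` in `V_k`. -/
def weightUp (d k : ℕ) : ℝ := √((k : ℝ) / d)

theorem weightDown_mul_self {d k : ℕ} (hk : k ≤ d) :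
    (weightDown d k : ℂ) * weightDown d k = ((d : ℂ) - k) / d := by
  have : (k : ℝ) ≤ d := by exact_mod_cast hk
  rw [weightDown, ← Complex.ofReal_mul, Real.mul_self_sqrt
    (div_nonneg (sub_nonneg.2 this) (Nat.cast_nonneg _))]
  simp

theorem weightUp_mul_self (d k : ℕ) : (weightUp d k : ℂ) * weightUp d k = (k : ℂ) / d := by
  rw [weightUp, ← Complex.ofReal_mul, Real.mul_self_sqrt (by positivity)]
  simp

theorem vTensor_apply_zero (d k : ℕ) (s : Conf (d - 1)) :
    vTensor d k 0 s = weightUp d k * symVec (d - 1) (k - 1) s := by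
  simp [vTensor, star_symVec, Matrix.vecMulVec_apply, weightUp]

theorem vTensor_apply_one (d k : ℕ) (s : Conf (d - 1)) :
    vTensor d k 1 s = weightDown d k * symVec (d - 1) k s := by
  simp [vTensor, star_symVec, Matrix.vecMulVec_apply, weightDown]

theorem star_vTensor_apply (d k : ℕ) (a : Fin 2) (s : Conf (d - 1)) :
    star (vTensor d k a s) = vTensor d k a s := by
  have h : ∀ m l (t : Conf m), star (symVec m l t) = symVec m l t :=
    fun m l t => congrFun (star_symVec m l) t
  fin_cases a
  · simp only [Fin.zero_eta, vTensor_apply_zero, star_mul', h, Complex.star_def,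
      Complex.conj_ofReal]
  · simp only [Fin.mk_one, vTensor_apply_one, star_mul', h, Complex.star_def,
      Complex.conj_ofReal]

theorem sum_vTensor_zero_mul_one (d k : ℕ) :
    ∑ s, vTensor d k 0 s * vTensor d k 1 s = 0 := by
  simp only [vTensor_apply_zero, vTensor_apply_one, mul_mul_mul_comm, ← Finset.mul_sum]
  -- For k = 0 truncated subtraction gives k - 1 = k and orthogonality fails, but `weightUp`
  -- vanishes.
  rcases Nat.eq_zero_or_pos k with rfl | hk
  · simp [weightUp]
  · rw [sum_symVec_mul_of_ne (by omega), mul_zero]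

theorem sum_vTensor_zero_sq {d k : ℕ} (hk : k ≤ d) :
    ∑ s, vTensor d k 0 s * vTensor d k 0 s = (k : ℂ) / d := by
  simp only [vTensor_apply_zero, mul_mul_mul_comm, ← Finset.mul_sum]
  rw [sum_symVec_sq (by omega), weightUp_mul_self, mul_one]

theorem sum_vTensor_one_sq {d k : ℕ} (hk : k ≤ d) :
    ∑ s, vTensor d k 1 s * vTensor d k 1 s = ((d : ℂ) - k) / d := by
  simp only [vTensor_apply_one, mul_mul_mul_comm, ← Finset.mul_sum]
  rw [weightDown_mul_self hk]
  -- For k = d no configuration of d - 1 spins has d ups, so normalization is unavailable; the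
  -- coefficient is 0.
  rcases hk.eq_or_lt with rfl | hk
  · simp
  · rw [sum_symVec_sq (by omega), mul_one]

/-- Each summand is diagonal with entries k/d and (d-k)/d, and both sum to (d+1)/2. -/
theorem sum_vTensor_mul_conjTranspose {d : ℕ} (hd : d ≠ 0) :
    ∑ k ∈ Finset.range (d + 1), vTensor d k * (vTensor d k)ᴴ = (((d : ℂ) + 1) / 2) • 1 := by
  have hd' : (d : ℂ) ≠ 0 := by exact_mod_cast hd
  have hs : ∑ k ∈ Finset.range (d + 1), (k : ℂ) / d = ((d : ℂ) + 1) / 2 := by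
    rw [← Finset.sum_div, div_eq_div_iff hd' two_ne_zero]
    have := Finset.sum_range_id_mul_two (d + 1)
    rw [Nat.add_sub_cancel] at this
    rw [mul_comm ((d : ℂ) + 1)]
    rw [← Nat.cast_sum]
    rw [mul_comm (d + 1)] at this
    exact_mod_cast this
  have hs' : ∑ k ∈ Finset.range (d + 1), ((d : ℂ) - k) / d = ((d : ℂ) + 1) / 2 := by
    rw [← Finset.sum_range_reflect, ← hs]
    refine Finset.sum_congr rfl fun k hk => ?_
    have : k ≤ d := Nat.lt_succ_iff.1 (Finset.mem_range.1 hk)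
    rw [show d + 1 - 1 - k = d - k by omega, Nat.cast_sub this]
    ring
  have hle : ∀ k ∈ Finset.range (d + 1), k ≤ d := fun k hk =>
    Nat.lt_succ_iff.1 (Finset.mem_range.1 hk)
  ext a b
  simp only [Matrix.sum_apply, Matrix.mul_apply, Matrix.conjTranspose_apply, star_vTensor_apply]
  fin_cases a <;> fin_cases b
  · simpa [← hs] using Finset.sum_congr rfl fun k hk => sum_vTensor_zero_sq (hle k hk)
  · simpa using Finset.sum_eq_zero fun k _ => sum_vTensor_zero_mul_one d k
  · simpa using Finset.sum_eq_zero fun k _ =>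
      (Finset.sum_congr rfl fun s _ => mul_comm _ _).trans (sum_vTensor_zero_mul_one d k)
  · simpa [← hs'] using Finset.sum_congr rfl fun k hk => sum_vTensor_one_sq (hle k hk)

/-- The operator `∑ₖ Vₖ* Vₖ`, a multiple of the projection onto the symmetric subspace. -/
def symGram (d : ℕ) : SpinMat (d - 1) :=
  ∑ k ∈ Finset.range (d + 1), (vTensor d k)ᴴ * vTensor d k

/-- The vector φ_j occurs in V_j with squared weight (d-j)/d and in V_{j+1} with (j+1)/d; the total
(d+1)/d does not depend on j. -/
theorem symGram_apply {d : ℕ} (hd : d ≠ 0) (s t : Conf (d - 1)) :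
    symGram d s t = if ups s = ups t then
      ((d : ℂ) + 1) / d * ((d - 1).choose (ups s) : ℂ)⁻¹ else 0 := by
  have hd' : (d : ℂ) ≠ 0 := by exact_mod_cast hd
  have hs := ups_le s
  have hle : ∀ k ∈ Finset.range (d + 1), k ≤ d := fun k hk =>
    Nat.lt_succ_iff.1 (Finset.mem_range.1 hk)
  have key : symGram d s t =
      ∑ k ∈ Finset.range (d + 1), (k : ℂ) / d *
        (symVec (d - 1) (k - 1) s * symVec (d - 1) (k - 1) t) +
      ∑ k ∈ Finset.range (d + 1), ((d : ℂ) - k) / d *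
        (symVec (d - 1) k s * symVec (d - 1) k t) := by
    rw [symGram, Matrix.sum_apply, ← Finset.sum_add_distrib]
    refine Finset.sum_congr rfl fun k hk => ?_
    rw [Matrix.mul_apply, Fin.sum_univ_two, ← weightUp_mul_self, ← weightDown_mul_self (hle k hk)]
    rw [Matrix.conjTranspose_apply, Matrix.conjTranspose_apply, star_vTensor_apply,
      star_vTensor_apply]
    simp only [vTensor_apply_zero, vTensor_apply_one]
    ring
  -- Splitting off k = 0, whose weight is zero, shifts k - 1 to k and aligns the two sums.
  rw [key, Finset.sum_range_succ']
  simp only [symVec_mul_self, Nat.add_sub_cancel]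
  by_cases h : ups s = ups t
  · rw [if_pos h, ← h]
    simp only [and_self, mul_ite, mul_zero, Finset.sum_ite_eq, Finset.mem_range]
    rw [if_pos (show ups s < d by omega), if_pos (show ups s < d + 1 by omega)]
    simp only [CharP.cast_eq_zero, zero_div, zero_mul, ite_self, add_zero]
    rw [← add_mul, ← add_div]
    congr 2
    push_cast
    ring
  · have : ∀ k, ¬ (ups s = k ∧ ups t = k) := fun k hk => h (hk.1.trans hk.2.symm)
    simp [h, this]

theorem posSemidef_symGram (d : ℕ) : (symGram d).PosSemidef :=
  Matrix.posSemidef_sum _ fun _ _ => Matrix.posSemidef_conjTranspose_mul_self _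

theorem symGram_diag_pos {d : ℕ} (hd : d ≠ 0) (s : Conf (d - 1)) : 0 < symGram d s s := by
  rw [symGram_apply hd, if_pos rfl]
  have h1 : 0 < (d - 1).choose (ups s) := Nat.choose_pos (ups_le s)
  have h2 : 0 < d := Nat.pos_of_ne_zero hd
  have : (0 : ℝ) < ((d : ℝ) + 1) / d * ((d - 1).choose (ups s) : ℝ)⁻¹ := by positivity
  have h := Complex.zero_lt_real.2 this
  push_cast at h
  exact h

/-- The tensor power of the singlet tensor. -/
def singletPower (m : ℕ) : SpinMat m := pureTensor fun _ => singlet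

theorem singletPower_apply {m : ℕ} (s t : Conf m) :
    singletPower m s t = if t = fun i => (s i).rev then (-1) ^ (m - ups s) else 0 := by
  have h : ∀ a b : Fin 2, singlet a b = if b = a.rev then (if a = 0 then 1 else -1) else 0 := by
    intro a b
    fin_cases a <;> fin_cases b <;> simp [singlet, Fin.rev]
  simp only [singletPower, pureTensor, Matrix.of_apply, h, Finset.prod_ite_zero, funext_iff, Finset.mem_univ,
    forall_const]
  congr 1
  rw [Finset.prod_ite, Finset.prod_const_one, one_mul, Finset.prod_const]
  congr 1
  have := Finset.card_filter_add_card_filter_not (s := (Finset.univ : Finset (Fin m)))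
    (fun i => s i = 0)
  simp only [Finset.card_univ, Fintype.card_fin] at this
  simp only [ups]
  omega

theorem singletPower_mul_apply {m : ℕ} (M : SpinMat m) (s t : Conf m) :
    (singletPower m * M) s t = (-1) ^ (m - ups s) * M (fun i => (s i).rev) t := by
  rw [Matrix.mul_apply, Finset.sum_eq_single fun i => (s i).rev]
  · rw [singletPower_apply, if_pos rfl]
  · intro u _ hu
    rw [singletPower_apply, if_neg hu, zero_mul]
  · simp

theorem mul_conjTranspose_singletPower_apply {m : ℕ} (M : SpinMat m) (s t : Conf m) :
    (M * (singletPower m)ᴴ) s t =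
      M s (fun i => (t i).rev) * (-1) ^ (m - ups t) := by
  rw [← Matrix.conjTranspose_conjTranspose M, ← Matrix.conjTranspose_mul,
    Matrix.conjTranspose_apply, singletPower_mul_apply]
  simp [mul_comm]

/-- Flipping all spins replaces j ups by d - 1 - j, which preserves the binomial coefficient; the
two signs cancel when `ups s = ups t`. This is what ties the right vertex to `QL`. -/
theorem singletPower_conj_symGram {d : ℕ} (hd : d ≠ 0) :
    singletPower (d - 1) * symGram d * (singletPower (d - 1))ᴴ = symGram d := by
  ext s t
  rw [mul_conjTranspose_singletPower_apply, singletPower_mul_apply, symGram_apply hd,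
    symGram_apply hd, ups_rev, ups_rev]
  have hs := ups_le s
  have ht := ups_le t
  by_cases h : ups s = ups t
  · rw [h, if_pos rfl, if_pos rfl, Nat.choose_symm ht, mul_right_comm, ← pow_add, ← two_mul,
      pow_mul]
    simp
  · rw [if_neg h, if_neg (by omega)]
    simp

theorem conjTranspose_singlet_mul_self : singletᴴ * singlet = 1 := by
  ext i j
  fin_cases i <;> fin_cases j <;> simp [singlet, Matrix.mul_apply, Fin.sum_univ_two]

theorem conjTranspose_singletPower_mul_self (m : ℕ) :
    (singletPower m)ᴴ * singletPower m = 1 := by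
  refine mul_eq_one_comm.1 ?_
  ext s t
  have h : (fun i => (s i).rev) = (fun i => (t i).rev) ↔ s = t := by
    simp [funext_iff]
  have h1 : singletPower m * (singletPower m)ᴴ = singletPower m * 1 * (singletPower m)ᴴ := by
    rw [Matrix.mul_one]
  rw [h1, mul_conjTranspose_singletPower_apply,
    singletPower_mul_apply, Matrix.one_apply, Matrix.one_apply]
  simp only [h]
  split_ifs with hst
  · rw [hst, mul_one, ← pow_add, ← two_mul, pow_mul]
    simp
  · simp

theorem wRight_eq (d k : ℕ) : wRight d k = singletPower (d - 1) * (vTensor d k)ᴴ := rfl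

/-! ### The vertex transfer operators and the bounds they give. -/

section Vertex

theorem QL_eq (d n : ℕ) : QL d n = (tensorPower (d - 1) siteTransfer ^ n) (symGram d) := by
  rw [QL, transferL, LinearMap.comp_apply]
  congr 1
  simp only [krausMap, LinearMap.coe_mk, AddHom.coe_mk, symGram, wLeft]
  refine Finset.sum_congr rfl fun k _ => ?_
  rw [Matrix.mul_one, Matrix.conjTranspose_mul, Matrix.mul_assoc, ← Matrix.mul_assoc singletᴴ,
    conjTranspose_singlet_mul_self, Matrix.one_mul]

theorem posDef_QL {d n : ℕ} (hd : d ≠ 0) (hn : n ≠ 0) : (QL d n).PosDef := by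
  rw [QL_eq]
  exact posDef_tensorPower_siteTransfer_pow hn (posSemidef_symGram d) (symGram_diag_pos hd)

theorem isCompletelyPositive_transferL (d n : ℕ) : IsCompletelyPositive (transferL d n) :=
  ((isCompletelyPositive_siteTransfer.tensorPower _).pow n).comp
    (isCompletelyPositive_krausMap d _)

theorem isCompletelyPositive_transferR (d n : ℕ) : IsCompletelyPositive (transferR d n) :=
  (isCompletelyPositive_krausMap d _).comp
    ((isCompletelyPositive_siteTransfer.tensorPower _).pow n)

theorem trace_krausMap {p q : Type} [Fintype p] [DecidableEq p] [Fintype q] [DecidableEq q]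
    (d : ℕ) (W : ℕ → Matrix p q ℂ) (B : Matrix p p ℂ) :
    (krausMap d W B).trace = (B * ∑ k ∈ Finset.range (d + 1), W k * (W k)ᴴ).trace := by
  simp only [krausMap, LinearMap.coe_mk, AddHom.coe_mk, Matrix.trace_sum, Matrix.mul_sum]
  refine Finset.sum_congr rfl fun k _ => ?_
  rw [Matrix.mul_assoc, Matrix.trace_mul_comm, Matrix.mul_assoc]

theorem sum_conj_mul_conjTranspose {p q r : Type} [Fintype p] [Fintype q] [Fintype r]
    (d : ℕ) (U : Matrix r p ℂ) (V : ℕ → Matrix p q ℂ) :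
    ∑ k ∈ Finset.range (d + 1), U * V k * (U * V k)ᴴ =
      U * (∑ k ∈ Finset.range (d + 1), V k * (V k)ᴴ) * Uᴴ := by
  simp only [Matrix.mul_sum, Matrix.sum_mul, Matrix.conjTranspose_mul, Matrix.mul_assoc]

theorem trace_transferL {d : ℕ} (hd : d ≠ 0) (n : ℕ) (B : Matrix (Fin 2) (Fin 2) ℂ) :
    (transferL d n B).trace = ((d : ℂ) + 1) / 2 * B.trace := by
  rw [transferL, LinearMap.comp_apply, trace_tensorPower_siteTransfer_pow, trace_krausMap]
  simp only [wLeft]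
  rw [sum_conj_mul_conjTranspose, sum_vTensor_mul_conjTranspose hd, Matrix.mul_smul, Matrix.mul_one,
    Matrix.smul_mul, mul_eq_one_comm.1 conjTranspose_singlet_mul_self, Matrix.mul_smul,
    Matrix.mul_one, Matrix.trace_smul, smul_eq_mul]

theorem transferR_one {d : ℕ} (hd : d ≠ 0) (n : ℕ) :
    transferR d n 1 = (((d : ℂ) + 1) / 2) • 1 := by
  rw [transferR, LinearMap.comp_apply, tensorPower_siteTransfer_pow_one,
    ← sum_vTensor_mul_conjTranspose hd]
  simp only [krausMap, LinearMap.coe_mk, AddHom.coe_mk, wRight_eq]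
  refine Finset.sum_congr rfl fun k _ => ?_
  rw [Matrix.mul_one, Matrix.conjTranspose_mul, Matrix.mul_assoc,
    ← Matrix.mul_assoc (singletPower (d - 1))ᴴ, conjTranspose_singletPower_mul_self,
    Matrix.one_mul, Matrix.conjTranspose_conjTranspose]

/-- The Gram operator is invariant under the singlet conjugation, and the symmetric transfer powers
move across the trace onto it. -/
theorem trace_transferR {d : ℕ} (hd : d ≠ 0) (n : ℕ) (A : SpinMat (d - 1)) :
    (transferR d n A).trace = (A * QL d n).trace := by
  rw [transferR, LinearMap.comp_apply, trace_krausMap, QL_eq,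
    ← trace_tensorPower_siteTransfer_pow_mul]
  simp only [wRight_eq]
  rw [sum_conj_mul_conjTranspose]
  simp only [Matrix.conjTranspose_conjTranspose]
  rw [← symGram, singletPower_conj_symGram hd]

/-- Pairing with ρ is half the conjugated trace, so `trace_transferR` on matrix units reads off the
entries of `QL`; Hermiticity removes the conjugate transpose. -/
theorem QR_eq {d n : ℕ} (hd : d ≠ 0) (hn : n ≠ 0) : QR d n = (1 / 2 : ℝ) • QL d n := by
  ext i j
  have h : hsInner (transferR d n (Matrix.single i j 1)) rho =
      1 / 2 * star (transferR d n (Matrix.single i j 1)).trace := by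
    rw [hsInner, rho, Matrix.mul_smul, Matrix.mul_one, Matrix.trace_smul, smul_eq_mul,
      Matrix.trace_conjTranspose]
  have hH : star (QL d n j i) = QL d n i j := (posDef_QL hd hn).isHermitian.apply i j
  simp only [QR, hsAdjoint, LinearMap.coe_mk, AddHom.coe_mk, Matrix.of_apply]
  rw [h, trace_transferR hd, Matrix.trace_single_mul]
  simp [← hH]

theorem qL_pos {d n : ℕ} (hd : d ≠ 0) (hn : n ≠ 0) : 0 < qL d n :=
  minEigenvalue_pos (posDef_QL hd hn)

theorem qR_eq {d n : ℕ} (hd : d ≠ 0) (hn : n ≠ 0) : qR d n = qL d n / 2 := by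
  rw [qR, QR_eq hd hn, minEigenvalue_smul (by norm_num), qL]
  ring

theorem opNorm_QL_pos {d n : ℕ} (hd : d ≠ 0) (hn : n ≠ 0) : 0 < opNorm (QL d n) := by
  refine opNorm_pos fun h => ?_
  have := (posDef_QL hd hn).diag_pos (i := fun _ => 0)
  rw [h] at this
  exact lt_irrefl _ this

theorem schattenInfty_transferL_sq_le {d : ℕ} (hd : d ≠ 0) (n : ℕ) :
    schattenInfty (transferL d n) ^ 2 ≤ opNorm (QL d n) * (((d : ℝ) + 1) / 2) := by
  refine (isCompletelyPositive_transferL d n).schattenInfty_sq_le (by positivity) fun A => ?_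
  rw [trace_transferL hd, hsNorm_sq]
  have : ((d : ℂ) + 1) / 2 = (((d : ℝ) + 1) / 2 : ℝ) := by push_cast; rfl
  rw [this, Complex.re_ofReal_mul]

theorem opNorm_transferR_one {d : ℕ} (hd : d ≠ 0) (n : ℕ) :
    opNorm (transferR d n 1) = ((d : ℝ) + 1) / 2 := by
  have : ((d : ℂ) + 1) / 2 = (((d : ℝ) + 1) / 2 : ℝ) := by push_cast; rfl
  rw [transferR_one hd, opNorm_smul, opNorm_one, this, Complex.norm_real, mul_one,
    Real.norm_of_nonneg (by positivity)]

theorem schattenInfty_transferR_sq_le {d : ℕ} (hd : d ≠ 0) (n : ℕ) :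
    schattenInfty (transferR d n) ^ 2 ≤ opNorm (QL d n) * (((d : ℝ) + 1) / 2) := by
  rw [mul_comm, ← opNorm_transferR_one hd n]
  refine (isCompletelyPositive_transferR d n).schattenInfty_sq_le (opNorm_nonneg _) fun A => ?_
  rw [trace_transferR hd, Matrix.trace_mul_comm]
  exact re_trace_mul_conjTranspose_mul_le _ _

/-- A common upper bound for the squares of `b_L^∞` and `b_R^∞`. -/
def bSqBound (d n : ℕ) : ℝ := 16 * rate n ^ 2 * (opNorm (QL d n) * (((d : ℝ) + 1) / 2)) / qL d n ^ 2

theorem bSqBound_pos {d n : ℕ} (hd : d ≠ 0) (hn : n ≠ 0) : 0 < bSqBound d n := by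
  have h1 := rate_pos n
  have h2 := opNorm_QL_pos hd hn
  have h3 := qL_pos hd hn
  unfold bSqBound
  positivity

theorem bLInfty_nonneg {d n : ℕ} (hd : d ≠ 0) (hn : n ≠ 0) : 0 ≤ bLInfty d n := by
  have h1 := rate_pos n
  have h2 := schattenInfty_nonneg (transferL d n)
  have h3 := qL_pos hd hn
  unfold bLInfty
  positivity

theorem bRInfty_nonneg {d n : ℕ} (hd : d ≠ 0) (hn : n ≠ 0) : 0 ≤ bRInfty d n := by
  have h1 := rate_pos n
  have h2 := schattenInfty_nonneg (transferR d n)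
  have h3 := qL_pos hd hn
  rw [bRInfty, qR_eq hd hn]
  positivity

theorem bLInfty_sq_le {d : ℕ} (hd : d ≠ 0) (n : ℕ) : bLInfty d n ^ 2 ≤ bSqBound d n := by
  rw [bLInfty, bSqBound, div_pow, mul_pow, mul_pow]
  norm_num only
  exact div_le_div_of_nonneg_right (mul_le_mul_of_nonneg_left
    (schattenInfty_transferL_sq_le hd n) (by positivity)) (by positivity)

theorem bRInfty_sq_le {d n : ℕ} (hd : d ≠ 0) (hn : n ≠ 0) : bRInfty d n ^ 2 ≤ bSqBound d n := by
  have h : bRInfty d n = 4 * rate n * schattenInfty (transferR d n) / qL d n := by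
    have := (qL_pos hd hn).ne'
    rw [bRInfty, qR_eq hd hn]
    field_simp
    norm_num only
    ring
  rw [h, bSqBound, div_pow, mul_pow, mul_pow]
  norm_num only
  exact div_le_div_of_nonneg_right (mul_le_mul_of_nonneg_left
    (schattenInfty_transferR_sq_le hd n) (by positivity)) (by positivity)

/-- Since q_R = q_L/2, both operator-norm quantities carry the prefactor 8a/q_L, against 4a/q_L for
the Schatten ones. This doubling on each side is the factor 4. -/
theorem four_mul_bSqBound_le {d n : ℕ} (hd : d ≠ 0) (hn : n ≠ 0) :
    4 * bSqBound d n ≤ bLOp d n * bROp d n := by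
  have hq := qL_pos hd hn
  have ha := rate_pos n
  have hL : opNorm (QL d n) ≤ inducedOpNorm (transferL d n) := opNorm_map_one_le_inducedOpNorm _
  have hR : ((d : ℝ) + 1) / 2 ≤ inducedOpNorm (transferR d n) :=
    (opNorm_transferR_one hd n).symm.trans_le (opNorm_map_one_le_inducedOpNorm _)
  have h : bLOp d n * bROp d n = 64 * rate n ^ 2 *
      (inducedOpNorm (transferL d n) * inducedOpNorm (transferR d n)) / qL d n ^ 2 := by
    rw [bLOp, bROp, qR_eq hd hn]
    field_simp
    ring
  have h' : 4 * bSqBound d n = 64 * rate n ^ 2 *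
      (opNorm (QL d n) * (((d : ℝ) + 1) / 2)) / qL d n ^ 2 := by
    rw [bSqBound]
    ring
  rw [h, h']
  exact div_le_div_of_nonneg_right (mul_le_mul_of_nonneg_left
    (mul_le_mul hL hR (by positivity) ((opNorm_nonneg _).trans hL)) (by positivity))
    (by positivity)

theorem bLOp_nonneg {d n : ℕ} (hd : d ≠ 0) (hn : n ≠ 0) : 0 ≤ bLOp d n :=
  div_nonneg (mul_nonneg (mul_nonneg (by norm_num) (rate_pos n).le)
    ((opNorm_nonneg _).trans (opNorm_map_one_le_inducedOpNorm _))) (qL_pos hd hn).le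

end Vertex

/-! ### Elementary inequalities, with r, s the Schatten and p, w the operator-norm quantities. -/

section RealInequalities

variable {r s p w t : ℝ}

theorem mul_le_of_sq_le (hr : r ^ 2 ≤ t) (hs : s ^ 2 ≤ t) : r * s ≤ t := by
  nlinarith [sq_nonneg (r - s)]

theorem lt_one_of_sq_le (hp1 : p ≤ 1) (hw1 : w ≤ 1) (hp0 : 0 ≤ p) (hr : r ^ 2 ≤ t)
    (hpw : 4 * t ≤ p * w) : r < 1 := by
  have : p * w ≤ 1 := by nlinarith
  nlinarith

/-- With u = √t and v = √(pw), AM–GM gives (1-p)(1-w) ≤ (1-v)². Since 0 < 2u ≤ v ≤ 1, this is less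
than (1-u)², and r, s ≤ u < 1 finishes. -/
theorem one_sub_mul_one_sub_lt (ht : 0 < t) (hr : r ^ 2 ≤ t) (hs : s ^ 2 ≤ t)
    (hpw : 4 * t ≤ p * w) (hp0 : 0 ≤ p) (hp1 : p ≤ 1) (hw1 : w ≤ 1) :
    (1 - p) * (1 - w) < (1 - r) * (1 - s) := by
  have hpw1 : p * w ≤ 1 := by nlinarith
  set u := √t with hu
  have hu0 : 0 < u := Real.sqrt_pos.2 ht
  have huu : u ^ 2 = t := Real.sq_sqrt ht.le
  have hru : r ≤ u := Real.le_sqrt_of_sq_le hr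
  have hsu : s ≤ u := Real.le_sqrt_of_sq_le hs
  set v := √(p * w) with hv
  have hv0 : 0 ≤ v := Real.sqrt_nonneg _
  have hvv : v ^ 2 = p * w := Real.sq_sqrt (by linarith)
  have hv1 : v ≤ 1 := by nlinarith
  have huv : 2 * u ≤ v := Real.le_sqrt_of_sq_le (by nlinarith)
  have hamgm : 2 * v ≤ p + w := by
    have hw0 : 0 ≤ p + w := by nlinarith
    refine abs_le_of_sq_le_sq' ?_ hw0 |>.2
    nlinarith [sq_nonneg (p - w)]
  calc (1 - p) * (1 - w) ≤ (1 - v) ^ 2 := by nlinarith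
    _ < (1 - u) ^ 2 := by nlinarith
    _ ≤ (1 - r) * (1 - s) := by nlinarith

end RealInequalities

theorem ne_zero_of_log_le {d n : ℕ} (hd : 2 ≤ d)
    (hn : Real.log ((d : ℝ) - 1) / Real.log 3 - Real.log (Real.log 3) / Real.log 3 + 1 / 2
      ≤ (n : ℝ)) : n ≠ 0 := by
  rintro rfl
  have hd' : (2 : ℝ) ≤ d := by exact_mod_cast hd
  have h3 : 0 < Real.log 3 := Real.log_pos (by norm_num)
  have h32 : Real.log 3 < 3 - 1 := Real.log_lt_sub_one_of_pos (by norm_num) (by norm_num)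
  have h1 : 0 ≤ Real.log ((d : ℝ) - 1) / Real.log 3 :=
    div_nonneg (Real.log_nonneg (by linarith)) h3.le
  -- From ln 3 < 2 one gets ln ln 3 ≤ ln 3 - 1 < (ln 3)/2, so the lower bound on n is positive.
  have h2 : Real.log (Real.log 3) / Real.log 3 < 1 / 2 := by
    rw [div_lt_iff₀ h3]
    linarith [Real.log_le_sub_one_of_pos h3]
  push_cast at hn
  linarith

end AKLT

end

theorem mainTheorem10 {V : Type*} (G : SimpleGraph V) [G.LocallyFinite] (d : ℕ) (hd : 2 ≤ d)
    (hG : G.IsRegularOfDegree d) (n : ℕ)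
    (hn : Real.log ((d : ℝ) - 1) / Real.log 3 - Real.log (Real.log 3) / Real.log 3 + 1 / 2
      ≤ (n : ℝ))
    (vL vR : V) (hLR : G.Adj vL vR) :
    AKLT.bLRInfty (G.degree vL) (G.degree vR) n < AKLT.bLROp (G.degree vL) (G.degree vR) n ∧
    (AKLT.bLOp (G.degree vL) n ≤ 1 → AKLT.bROp (G.degree vR) n ≤ 1 →
      AKLT.bLInfty (G.degree vL) n < 1 ∧ AKLT.bRInfty (G.degree vR) n < 1 ∧
      √((1 - AKLT.bLOp (G.degree vL) n) * (1 - AKLT.bROp (G.degree vR) n)) <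
        √((1 - AKLT.bLInfty (G.degree vL) n) * (1 - AKLT.bRInfty (G.degree vR) n))) ∧
    (AKLT.bLOp (G.degree vL) n < 1 → AKLT.bROp (G.degree vR) n < 1 →
      AKLT.deltaInfty (G.degree vL) (G.degree vR) n <
        AKLT.deltaOp (G.degree vL) (G.degree vR) n) := by
  rw [hG vL, hG vR]
  have hn0 := AKLT.ne_zero_of_log_le hd hn
  have hd0 : d ≠ 0 := by omega
  have ha := AKLT.rate_pos n
  have ht := AKLT.bSqBound_pos hd0 hn0
  have hr := AKLT.bLInfty_sq_le hd0 n
  have hs := AKLT.bRInfty_sq_le hd0 hn0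
  have hpw := AKLT.four_mul_bSqBound_le hd0 hn0
  have hp0 := AKLT.bLOp_nonneg hd0 hn0
  have hrs := AKLT.mul_le_of_sq_le hr hs
  have h1 : AKLT.bLRInfty d d n < AKLT.bLROp d d n := by
    rw [AKLT.bLRInfty, AKLT.bLROp, div_lt_div_iff₀ (by positivity) (by positivity)]
    -- After clearing denominators the point is 2rs ≤ 2t < 4t ≤ pw; strictness comes from t > 0.
    nlinarith
  have h2 := fun hp1 hw1 => AKLT.one_sub_mul_one_sub_lt ht hr hs hpw hp0 hp1 hw1
  refine ⟨h1, fun hp1 hw1 => ⟨AKLT.lt_one_of_sq_le hp1 hw1 hp0 hr hpw,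
    AKLT.lt_one_of_sq_le hp1 hw1 hp0 hs hpw, Real.sqrt_lt_sqrt ?_ (h2 hp1 hw1)⟩,
    fun hp1 hw1 => ?_⟩
  · exact mul_nonneg (sub_nonneg.2 hp1) (sub_nonneg.2 hw1)
  · have hD := mul_pos (sub_pos.2 hp1) (sub_pos.2 hw1)
    have hlt := h2 hp1.le hw1.le
    -- The factor 4a cancels the 8a in `bLROp` to leave pw/2, and rs ≤ t ≤ 2t ≤ pw/2.
    have hnum : 4 * AKLT.rate n + AKLT.bLInfty d n * AKLT.bRInfty d n ≤
        4 * AKLT.rate n * (1 + AKLT.bLROp d d n) := by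
      have : 4 * AKLT.rate n * (1 + AKLT.bLROp d d n) =
          4 * AKLT.rate n + AKLT.bLOp d n * AKLT.bROp d n / 2 := by
        rw [AKLT.bLROp]
        field_simp
        ring
      linarith
    have hnum0 : 0 ≤ 4 * AKLT.rate n + AKLT.bLInfty d n * AKLT.bRInfty d n := by
      have := mul_nonneg (AKLT.bLInfty_nonneg hd0 hn0) (AKLT.bRInfty_nonneg hd0 hn0)
      positivity
    refine mul_lt_mul_of_pos_left (add_lt_add_of_lt_of_le ?_ ?_) (by positivity)
    · exact one_div_lt_one_div_of_lt (Real.sqrt_pos.2 hD) (Real.sqrt_lt_sqrt hD.le hlt)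
    · exact div_le_div₀ (hnum0.trans hnum) hnum hD hlt.le
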